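/- Let $\mathcal U,\mathcal V,\mathcal X$ be finite-dimensional real Euclidean spaces. Let $p:\mathcal U\to(-\infty,\infty]$ and $q:\mathcal V\to(-\infty,\infty]$ be closed proper convex functions, let $\phi:\mathcal U\times\mathcal V\to\mathbb R$ be a differentiable convex function with Lipschitz continuous gradient, let $\mathcal A:\mathcal X\to\mathcal U$ and $\mathcal B:\mathcal X\to\mathcal V$ be linear, with adjoints $\mathcal A^*,\mathcal B^*$, and let $c\in\mathcal X$. Consider the problem $$\min_{u,v}\ p(u)+q(v)+\phi(u,v)\quad\text{subject to}\quad \mathcal A^*u+\mathcal B^*v=c. \tag{P}$$ Write $w=(u,v)$, $w^k=(u^k,v^k)$, and $\|z\|_{\mathcal G}^2=\langle z,\mathcal Gz\rangle$ for a self-adjoint operator $\mathcal G$. Let $\partial^2\phi(w)$ be Clarke's generalized Hessian of $\phi$ at $w$, that is, the convex hull of all limits of $\nabla^2\phi(w_i)$ along sequences $w_i\to w$ of points at which $\nabla^2\phi$ exists. Let $\mathcal Q$ on $\mathcal U\times\mathcal V$, $\mathcal D_1$ on $\mathcal U$ and $\mathcal D_2$ on $\mathcal V$ be self-adjoint positive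 semidefinite operators such that, with $\mathcal H=\mathrm{Diag}(\mathcal D_1,\mathcal D_2)$, $$\mathcal Q\preceq\mathcal W\preceq\mathcal Q+\mathcal H\qquad\text{for all } w \text{ and all } \mathcal W\in\partial^2\phi(w).$$ Let $\mathcal Q_{12},\mathcal W_{12}:\mathcal V\to\mathcal U$ be the upper right blocks of $\mathcal Q,\mathcal W$, let $\mathcal Q_{22}:\mathcal V\to\mathcal V$ be the lower right block of $\mathcal Q$, and let $\eta\in[0,1]$ be such that $$|\langle u,(\mathcal W_{12}-\mathcal Q_{12})v\rangle|\le\tfrac{\eta}{2}\big(\|u\|_{\mathcal D_1}^2+\|v\|_{\mathcal D_2}^2\big)$$ for every $\mathcal W\in\bigcup_{w'\in\mathcal U\times\mathcal V}\partial^2\phi(w')$ and all $u\in\mathcal U$, $v\in\mathcal V$. Let $$\hat\phi(w;w')=\phi(w')+\langle\nabla\phi(w'),w-w'\rangle+\tfrac12\|w'-w\|^2_{\mathcal Q+\mathcal H}.$$ Let $\sigma>0$, $\tau>0$, and let $\mathcal S$ on $\mathcal U$ and $\mathcal T$ on $\mathcal V$ be self-adjoint positive semidefinite operators. Put $$\widehat{\mathcal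 L}_\sigma(u,v;(x,w'))=p(u)+q(v)+\hat\phi((u,v);w')+\langle x,\mathcal A^*u+\mathcal B^*v-c\rangle+\tfrac\sigma2\|\mathcal A^*u+\mathcal B^*v-c\|^2 .$$ Suppose that (P) has an optimal solution, that there is $(\hat u,\hat v)\in\mathrm{ri}(\mathrm{dom}\,p\times\mathrm{dom}\,q)$ with $\mathcal A^*\hat u+\mathcal B^*\hat v=c$, and that $\{(u^k,v^k,x^k)\}_{k\ge0}$ is a sequence generated by the majorized ADMM: $u^0\in\mathrm{dom}\,p$, $v^0\in\mathrm{dom}\,q$, $x^0\in\mathcal X$ and, for all $k\ge0$, $$u^{k+1}\in\arg\min_u\{\widehat{\mathcal L}_\sigma(u,v^k;(x^k,w^k))+\tfrac12\|u-u^k\|^2_{\mathcal S}\},\qquad v^{k+1}\in\arg\min_v\{\widehat{\mathcal L}_\sigma(u^{k+1},v;(x^k,w^k))+\tfrac12\|v-v^k\|^2_{\mathcal T}\},$$ $$x^{k+1}=x^k+\tau\sigma(\mathcal A^*u^{k+1}+\mathcal B^*v^{k+1}-c).$$ For $k\ge0$ put $\tilde x^{k+1}=x^k+\sigma(\mathcal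 A^*u^{k+1}+\mathcal B^*v^{k+1}-c)$, $$\Xi_{k+1}=\|v^{k+1}-v^k\|^2_{\mathcal D_2+\mathcal T}+\eta\|u^{k+1}-u^k\|^2_{\mathcal D_1},$$ $$\Theta_{k+1}=\|u^{k+1}-u^k\|^2_{\mathcal S}+\|v^{k+1}-v^k\|^2_{\mathcal T}+\tfrac14\|w^{k+1}-w^k\|^2_{\mathcal Q},$$ $$\Gamma_{k+1}=\Theta_{k+1}+\min(\tau,1+\tau-\tau^2)\|v^{k+1}-v^k\|^2_{\sigma\mathcal B\mathcal B^*}-\|u^{k+1}-u^k\|^2_{\eta\mathcal D_1}-\|v^{k+1}-v^k\|^2_{\eta\mathcal D_2},$$ and for $(u,v,x)\in\mathcal U\times\mathcal V\times\mathcal X$, $w=(u,v)$, $$\Phi_k(u,v,x)=(\tau\sigma)^{-1}\|x^k-x\|^2+\|u^k-u\|^2_{\mathcal D_1+\mathcal S}+\|v^k-v\|^2_{\mathcal Q_{22}+\mathcal D_2+\mathcal T}+\tfrac12\|w^k-w\|^2_{\mathcal Q}+\sigma\|\mathcal A^*u+\mathcal B^*v^k-c\|^2,$$ $$\Psi_k(u,v,x)=\Phi_k(u,v,x)+\|w^k-w\|^2_{\mathcal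 Q}+\max(1-\tau,1-\tau^{-1})\,\sigma\|\mathcal A^*u^k+\mathcal B^*v^k-c\|^2,$$ $$\begin{aligned}G_{k+1}(u,v,x)={}&(p(u^{k+1})+q(v^{k+1}))-(p(u)+q(v))+\langle w^{k+1}-w,\nabla\phi(w)\rangle+\langle u^{k+1}-u,\mathcal Ax\rangle\\&+\langle v^{k+1}-v,\mathcal Bx\rangle-\langle\tilde x^{k+1}-x,\mathcal A^*u+\mathcal B^*v-c\rangle,\end{aligned}$$ where $G_{k+1}(u,v,x)=-\infty$ if $p(u)+q(v)=\infty$. (i) If $\tau\in(0,1]$, then for all $k\ge0$ and all $(u,v,x)\in\mathcal U\times\mathcal V\times\mathcal X$, $$G_{k+1}(u,v,x)+\tfrac12\big(\Phi_{k+1}(u,v,x)-\Phi_k(u,v,x)\big)\le-\tfrac12\Big(\Theta_{k+1}+\sigma\|\mathcal A^*u^{k+1}+\mathcal B^*v^k-c\|^2+(1-\tau)\sigma\|\mathcal A^*u^{k+1}+\mathcal B^*v^{k+1}-c\|^2\Big).$$ (ii) For every $\tau>0$, all $k\ge1$ and all $(u,v,x)\in\mathcal U\times\mathcal V\times\mathcal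 X$, $$G_{k+1}(u,v,x)+\tfrac12\big((\Psi_{k+1}(u,v,x)+\Xi_{k+1})-(\Psi_k(u,v,x)+\Xi_k)\big)\le-\tfrac12\Big(\Gamma_{k+1}+\min(1,1+\tau^{-1}-\tau)\,\sigma\|\mathcal A^*u^{k+1}+\mathcal B^*v^{k+1}-c\|^2\Big).$$ -/

import Mathlib

namespace MajADMM

noncomputable section

section Convex

variable {E : Type*} [NormedAddCommGroup E] [InnerProductSpace ℝ E]

/-- The effective domain of an extended-real-valued function. -/
def dom (f : E → EReal) : Set E := {z | f z < ⊤}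

/-- `f : E → (-∞, ∞]` is a closed (lower semicontinuous) proper convex function. -/
structure ClosedProperConvex (f : E → EReal) : Prop where
  ne_bot : ∀ z, f z ≠ ⊥
  dom_nonempty : (dom f).Nonempty
  closed : LowerSemicontinuous f
  convex_epigraph : Convex ℝ {y : E × ℝ | f y.1 ≤ (y.2 : EReal)}

/-- `‖z‖²_G = ⟨z, G z⟩`. -/
def sqNorm (G : E →L[ℝ] E) (z : E) : ℝ := inner ℝ z (G z)

/-- Clarke's generalized Hessian of `φ` at `w`: the convex hull of all limits of `∇²φ(wⁱ)` along
sequences `wⁱ → w` of points at which `∇φ` is differentiable. -/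
def clarkeHessian [FiniteDimensional ℝ E] (φ : E → ℝ) (w : E) : Set (E →L[ℝ] E) :=
  convexHull ℝ {M | ∃ z : ℕ → E, Filter.Tendsto z Filter.atTop (nhds w) ∧
    (∀ i, DifferentiableAt ℝ (gradient φ) (z i)) ∧
    Filter.Tendsto (fun i => fderiv ℝ (gradient φ) (z i)) Filter.atTop (nhds M)}

end Convex

section Blocks

variable {U V : Type*} [NormedAddCommGroup U] [InnerProductSpace ℝ U]
  [NormedAddCommGroup V] [InnerProductSpace ℝ V]

/-- The point `w = (u, v)` of the Euclidean product space `U × V`, whose inner product is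
`⟨(u, v), (u', v')⟩ = ⟨u, u'⟩ + ⟨v, v'⟩`. -/
abbrev pair (u : U) (v : V) : WithLp 2 (U × V) := WithLp.toLp 2 (u, v)

/-- The embedding `u ↦ (u, 0)`. -/
def inl : U →L[ℝ] WithLp 2 (U × V) :=
  (WithLp.prodContinuousLinearEquiv 2 ℝ U V).symm.toContinuousLinearMap ∘L
    ContinuousLinearMap.inl ℝ U V

/-- The embedding `v ↦ (0, v)`. -/
def inr : V →L[ℝ] WithLp 2 (U × V) :=
  (WithLp.prodContinuousLinearEquiv 2 ℝ U V).symm.toContinuousLinearMap ∘L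
    ContinuousLinearMap.inr ℝ U V

/-- The projection `(u, v) ↦ u`. -/
def fst : WithLp 2 (U × V) →L[ℝ] U :=
  ContinuousLinearMap.fst ℝ U V ∘L
    (WithLp.prodContinuousLinearEquiv 2 ℝ U V).toContinuousLinearMap

/-- The projection `(u, v) ↦ v`. -/
def snd : WithLp 2 (U × V) →L[ℝ] V :=
  ContinuousLinearMap.snd ℝ U V ∘L
    (WithLp.prodContinuousLinearEquiv 2 ℝ U V).toContinuousLinearMap

/-- The upper right block `W₁₂ : V → U` of an operator `W` on `U × V`. -/
def block12 (W : WithLp 2 (U × V) →L[ℝ] WithLp 2 (U × V)) : V →L[ℝ] U := fst ∘L W ∘L inr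

/-- The lower right block `W₂₂ : V → V` of an operator `W` on `U × V`. -/
def block22 (W : WithLp 2 (U × V) →L[ℝ] WithLp 2 (U × V)) : V →L[ℝ] V := snd ∘L W ∘L inr

/-- The block diagonal operator `Diag(D₁, D₂)`, that is `(u, v) ↦ (D₁ u, D₂ v)`. -/
def diag (D₁ : U →L[ℝ] U) (D₂ : V →L[ℝ] V) : WithLp 2 (U × V) →L[ℝ] WithLp 2 (U × V) :=
  inl ∘L D₁ ∘L fst + inr ∘L D₂ ∘L snd

end Blocks

/-- The data (without any assumption) of the problem
`min p(u) + q(v) + φ(u, v)` subject to `A* u + B* v = c`,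
and of the majorized ADMM applied to it. -/
structure Data (U V X : Type*) [NormedAddCommGroup U] [InnerProductSpace ℝ U]
    [NormedAddCommGroup V] [InnerProductSpace ℝ V]
    [NormedAddCommGroup X] [InnerProductSpace ℝ X] where
  p : U → EReal
  q : V → EReal
  φ : WithLp 2 (U × V) → ℝ
  A : X →L[ℝ] U
  B : X →L[ℝ] V
  c : X
  /-- lower bound for the generalized Hessian of `φ` -/
  Q : WithLp 2 (U × V) →L[ℝ] WithLp 2 (U × V)
  /-- first diagonal block of `H = Diag(D₁, D₂)` -/
  D₁ : U →L[ℝ] U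
  /-- second diagonal block of `H = Diag(D₁, D₂)` -/
  D₂ : V →L[ℝ] V
  /-- constant controlling the off-diagonal block of the generalized Hessian -/
  η : ℝ
  /-- penalty parameter -/
  σ : ℝ
  /-- step length -/
  τ : ℝ
  /-- proximal term of the `u`-step -/
  S : U →L[ℝ] U
  /-- proximal term of the `v`-step -/
  T : V →L[ℝ] V

namespace Data

variable {U V X : Type*} [NormedAddCommGroup U] [InnerProductSpace ℝ U] [FiniteDimensional ℝ U]
  [NormedAddCommGroup V] [InnerProductSpace ℝ V] [FiniteDimensional ℝ V]
  [NormedAddCommGroup X] [InnerProductSpace ℝ X] [FiniteDimensional ℝ X]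
  (P : Data U V X)

/-- The residual `A* u + B* v - c`. -/
def res (u : U) (v : V) : X :=
  ContinuousLinearMap.adjoint P.A u + ContinuousLinearMap.adjoint P.B v - P.c

/-- The objective `θ(u, v) = p(u) + q(v) + φ(u, v)`. -/
def θ (u : U) (v : V) : EReal := P.p u + P.q v + (P.φ (pair u v) : EReal)

/-- `(u, v)` is an optimal solution of the problem. -/
def IsSolution (u : U) (v : V) : Prop :=
  P.res u v = 0 ∧ ∀ (u' : U) (v' : V), P.res u' v' = 0 → P.θ u v ≤ P.θ u' v'

/-- The constraint qualification: some `(û, v̂) ∈ ri (dom p × dom q)` satisfies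
`A* û + B* v̂ = c`. -/
def ConstraintQualification : Prop :=
  ∃ y ∈ intrinsicInterior ℝ (dom P.p ×ˢ dom P.q), P.res y.1 y.2 = 0

/-- The operator `H = Diag(D₁, D₂)`. -/
def H : WithLp 2 (U × V) →L[ℝ] WithLp 2 (U × V) := diag P.D₁ P.D₂

/-- `Q ⪯ W ⪯ Q + H` for every generalized Hessian `W` of `φ`. -/
def HessianBounds : Prop :=
  ∀ w, ∀ W ∈ clarkeHessian P.φ w, (W - P.Q).IsPositive ∧ (P.Q + P.H - W).IsPositive

/-- `|⟨u, (W₁₂ - Q₁₂) v⟩| ≤ (η / 2) (‖u‖²_{D₁} + ‖v‖²_{D₂})` for every generalized Hessian `W`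
of `φ` (at any point) and all vectors `u`, `v`. -/
def CrossControl : Prop :=
  ∀ w, ∀ W ∈ clarkeHessian P.φ w, ∀ (u : U) (v : V),
    |inner ℝ u ((block12 W - block12 P.Q) v)| ≤
      P.η / 2 * (sqNorm P.D₁ u + sqNorm P.D₂ v)

/-- The majorization `φ̂(w; w') = φ(w') + ⟨∇φ(w'), w - w'⟩ + ½ ‖w' - w‖²_{Q + H}`. -/
def φhat (w w' : WithLp 2 (U × V)) : ℝ :=
  P.φ w' + inner ℝ (gradient P.φ w') (w - w') + 1 / 2 * sqNorm (P.Q + P.H) (w' - w)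

/-- The majorized augmented Lagrangian function `L̂_σ((u, v); (x, w'))`. -/
def augLagrangian (u : U) (v : V) (x : X) (w' : WithLp 2 (U × V)) : EReal :=
  P.p u + P.q v +
    ((P.φhat (pair u v) w' + inner ℝ x (P.res u v) + P.σ / 2 * ‖P.res u v‖ ^ 2 : ℝ) : EReal)

/-- `(uᵏ, vᵏ, xᵏ)` is a sequence generated by the majorized ADMM. -/
structure IsIterates (u : ℕ → U) (v : ℕ → V) (x : ℕ → X) : Prop where
  init_u : u 0 ∈ dom P.p
  init_v : v 0 ∈ dom P.q
  step_u : ∀ k, IsMinOn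
    (fun u' => P.augLagrangian u' (v k) (x k) (pair (u k) (v k)) +
      ((1 / 2 * sqNorm P.S (u' - u k) : ℝ) : EReal)) Set.univ (u (k + 1))
  step_v : ∀ k, IsMinOn
    (fun v' => P.augLagrangian (u (k + 1)) v' (x k) (pair (u k) (v k)) +
      ((1 / 2 * sqNorm P.T (v' - v k) : ℝ) : EReal)) Set.univ (v (k + 1))
  step_x : ∀ k, x (k + 1) = x k + (P.τ * P.σ) • P.res (u (k + 1)) (v (k + 1))

section Quantities

variable (us : ℕ → U) (vs : ℕ → V) (xs : ℕ → X)

/-- `x̃ᵏ⁺¹ = xᵏ + σ (A* uᵏ⁺¹ + B* vᵏ⁺¹ - c)`. -/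
def xtildeSucc (k : ℕ) : X := xs k + P.σ • P.res (us (k + 1)) (vs (k + 1))

/-- `Ξ_{k+1} = ‖vᵏ⁺¹ - vᵏ‖²_{D₂ + T} + η ‖uᵏ⁺¹ - uᵏ‖²_{D₁}`. -/
def ΞSucc (k : ℕ) : ℝ :=
  sqNorm (P.D₂ + P.T) (vs (k + 1) - vs k) + P.η * sqNorm P.D₁ (us (k + 1) - us k)

/-- `Θ_{k+1} = ‖uᵏ⁺¹ - uᵏ‖²_S + ‖vᵏ⁺¹ - vᵏ‖²_T + ¼ ‖wᵏ⁺¹ - wᵏ‖²_Q`. -/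
def ΘSucc (k : ℕ) : ℝ :=
  sqNorm P.S (us (k + 1) - us k) + sqNorm P.T (vs (k + 1) - vs k) +
    1 / 4 * sqNorm P.Q (pair (us (k + 1)) (vs (k + 1)) - pair (us k) (vs k))

/-- `Γ_{k+1} = Θ_{k+1} + min(τ, 1 + τ - τ²) ‖vᵏ⁺¹ - vᵏ‖²_{σ B B*} - ‖uᵏ⁺¹ - uᵏ‖²_{η D₁}
- ‖vᵏ⁺¹ - vᵏ‖²_{η D₂}`. -/
def ΓSucc (k : ℕ) : ℝ :=
  P.ΘSucc us vs k +
    min P.τ (1 + P.τ - P.τ ^ 2) *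
      sqNorm (P.σ • (P.B ∘L ContinuousLinearMap.adjoint P.B)) (vs (k + 1) - vs k) -
    sqNorm (P.η • P.D₁) (us (k + 1) - us k) - sqNorm (P.η • P.D₂) (vs (k + 1) - vs k)

/-- `Φ_k(u, v, x)`. -/
def Φ (k : ℕ) (u : U) (v : V) (x : X) : ℝ :=
  (P.τ * P.σ)⁻¹ * ‖xs k - x‖ ^ 2 + sqNorm (P.D₁ + P.S) (us k - u) +
    sqNorm (block22 P.Q + P.D₂ + P.T) (vs k - v) +
    1 / 2 * sqNorm P.Q (pair (us k) (vs k) - pair u v) +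
    P.σ * ‖P.res u (vs k)‖ ^ 2

/-- `Ψ_k(u, v, x)`. -/
def Ψ (k : ℕ) (u : U) (v : V) (x : X) : ℝ :=
  P.Φ us vs xs k u v x + sqNorm P.Q (pair (us k) (vs k) - pair u v) +
    max (1 - P.τ) (1 - P.τ⁻¹) * P.σ * ‖P.res (us k) (vs k)‖ ^ 2

/-- The variational-inequality gap
`(p(uᵏ⁺¹) + q(vᵏ⁺¹)) - (p(u) + q(v)) + ⟨wᵏ⁺¹ - w, ∇φ(w)⟩ + ⟨uᵏ⁺¹ - u, A x⟩ + ⟨vᵏ⁺¹ - v, B x⟩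
- ⟨x̃ᵏ⁺¹ - x, A* u + B* v - c⟩`, which is `-∞` when `p(u) + q(v) = ∞`. -/
def viGapSucc (k : ℕ) (u : U) (v : V) (x : X) : EReal :=
  (P.p (us (k + 1)) + P.q (vs (k + 1))) - (P.p u + P.q v) +
    ((inner ℝ (pair (us (k + 1)) (vs (k + 1)) - pair u v) (gradient P.φ (pair u v)) +
      inner ℝ (us (k + 1) - u) (P.A x) + inner ℝ (vs (k + 1) - v) (P.B x) -
      inner ℝ (P.xtildeSucc us vs xs k - x) (P.res u v) : ℝ) : EReal)

end Quantities

end Data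

end

end MajADMM

/-! Each subproblem objective is a convex function plus a function that is quadratic along segments,
so its minimality is a variational inequality. Adding the inequalities of the `u`- and `v`-steps at
a test point leaves three groups of terms. The gradient at the old iterate is traded for the
gradient at the test point by quadratic bounds on `φ` (`inner_gradient_le`). The proximal terms
telescope by the three-point identity. The multiplier terms telescope by `multiplier_identity`. What
remains, in `viGapReal_add_le`, is a sum of residual squares and one `Q`-cross term: the `u`-step
does not yet see the new `v`.

For (i) Young's inequality disposes of that cross term. For (ii) the mixed residual at `(u^{k+1},
v^k)` is expanded around the new residual, and the resulting inner product is bounded by comparing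
two consecutive `v`-steps (`IsIterates.inner_res_le`). This comparison needs the change of the
gradient in `v`, controlled by the Hessian bounds and `η`; `Ξ` absorbs its old terms, and
`residual_estimate` settles the dependence on `τ`.

Since `φ` need not be twice differentiable, Hessian information enters only at points where the
gradient is differentiable. Rademacher's theorem together with Fubini makes that enough. -/

namespace MajADMM

noncomputable section

/-! ### From almost-everywhere derivative bounds to increments and quadratic bounds -/

section Analysis

open MeasureTheory Filter Topology

/-- For a Lipschitz map along almost every line in a fixed direction, a lower bound on the
directional derivative at the differentiability points integrates to a bound on increments. -/
theorem le_inner_sub_of_le_inner_fderiv {E F : Type*}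
    [NormedAddCommGroup E] [NormedSpace ℝ E] [FiniteDimensional ℝ E]
    [NormedAddCommGroup F] [InnerProductSpace ℝ F] [FiniteDimensional ℝ F]
    {g : E → F} {L : NNReal} (hg : LipschitzWith L g) (z : F) (d : E) {m : ℝ}
    (hm : ∀ y, DifferentiableAt ℝ g y → m ≤ inner ℝ z (fderiv ℝ g y d)) (w : E) :
    m ≤ inner ℝ z (g (w + d) - g w) := by
  borelize E
  let μ : Measure E := Measure.addHaar
  have hmeas : MeasurableSet {x : E × ℝ | DifferentiableAt ℝ g (x.1 + x.2 • d)} :=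
    (measurableSet_of_differentiableAt ℝ g).preimage
      (f := fun x : E × ℝ => x.1 + x.2 • d) (by fun_prop)
  -- The line through the given `w` may miss every differentiability point. For fixed `t`,
  -- Rademacher and translation invariance cover almost every `x`; Fubini then exchanges the
  -- quantifiers.
  have hline : ∀ᵐ x ∂μ, ∀ᵐ t : ℝ, DifferentiableAt ℝ g (x + t • d) := by
    refine (Measure.ae_ae_comm (p := fun x t => DifferentiableAt ℝ g (x + t • d)) hmeas).2 ?_
    refine Eventually.of_forall fun t => ?_
    exact (measurePreserving_add_right μ (t • d)).quasiMeasurePreserving.ae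
      hg.ae_differentiableAt
  have hcont : Continuous fun x => inner ℝ z (g (x + d) - g x) := by
    have := hg.continuous
    fun_prop
  have hclosed : IsClosed {x | m ≤ inner ℝ z (g (x + d) - g x)} :=
    isClosed_le continuous_const hcont
  have hae : ∀ᵐ x ∂μ, m ≤ inner ℝ z (g (x + d) - g x) := by
    filter_upwards [hline] with x hx
    let f : ℝ → ℝ := fun t => inner ℝ z (g (x + t • d))
    have hf : ∃ K, LipschitzWith K f := by
      have h1 : LipschitzWith (‖innerSL ℝ z‖₊ * (L * ‖(ContinuousLinearMap.toSpanSingleton ℝ d)‖₊))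
          f := by
        have h2 : LipschitzWith ‖(ContinuousLinearMap.toSpanSingleton ℝ d)‖₊
            fun t : ℝ => x + t • d := by
          refine LipschitzWith.of_dist_le_mul fun s t => ?_
          simpa using
            (ContinuousLinearMap.toSpanSingleton ℝ d).lipschitz.dist_le_mul s t
        exact (innerSL ℝ z).lipschitz.comp (hg.comp h2)
      exact ⟨_, h1⟩
    obtain ⟨K, hK⟩ := hf
    have hac : AbsolutelyContinuousOnInterval f 0 1 :=
      (hK.lipschitzOnWith (s := Set.uIcc 0 1)).absolutelyContinuousOnInterval
    have hint := hac.integral_deriv_eq_sub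
    have hder : ∀ᵐ t : ℝ, m ≤ deriv f t := by
      filter_upwards [hx] with t ht
      have h1 : HasDerivAt (fun s : ℝ => x + s • d) d t := by
        simpa using ((hasDerivAt_id t).smul_const d).const_add x
      have h2 : HasDerivAt f (inner ℝ z (fderiv ℝ g (x + t • d) d)) t :=
        ((innerSL ℝ z).hasFDerivAt.comp_hasDerivAt t (ht.hasFDerivAt.comp_hasDerivAt t h1))
      rw [h2.deriv]
      exact hm _ ht
    have hle : ∫ t in (0 : ℝ)..1, m ≤ ∫ t in (0 : ℝ)..1, deriv f t :=
      intervalIntegral.integral_mono_ae zero_le_one (by simp) hac.intervalIntegrable_deriv hder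
    rw [hint] at hle
    simpa [f, inner_sub_right] using hle
  -- A conull set is dense, and the condition is closed in `x`, so the exceptional lines are
  -- recovered by continuity.
  have hdense : Dense {x | m ≤ inner ℝ z (g (x + d) - g x)} := Measure.dense_of_ae hae
  have := hclosed.closure_eq ▸ hdense.closure_eq
  exact (this ▸ Set.mem_univ w : w ∈ {x | m ≤ inner ℝ z (g (x + d) - g x)})

/-- A lower bound on the monotonicity of the gradient gives a quadratic lower bound. -/
theorem add_inner_add_le_of_le_inner_sub {E : Type*} [NormedAddCommGroup E]
    [InnerProductSpace ℝ E] [CompleteSpace E] {φ : E → ℝ} {g : E → E}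
    (hφ : ∀ x, HasGradientAt φ (g x) x) {R : E →L[ℝ] E}
    (hR : ∀ x d, inner ℝ d (R d) ≤ inner ℝ d (g (x + d) - g x)) (x d : E) :
    φ x + inner ℝ (g x) d + 1 / 2 * inner ℝ d (R d) ≤ φ (x + d) := by
  let f : ℝ → ℝ := fun t => φ (x + t • d) - t * inner ℝ (g x) d - 1 / 2 * t ^ 2 * inner ℝ d (R d)
  have hder : ∀ t, HasDerivAt f
      (inner ℝ (g (x + t • d)) d - inner ℝ (g x) d - t * inner ℝ d (R d)) t := by
    intro t
    have h1 : HasDerivAt (fun s : ℝ => x + s • d) d t := by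
      simpa using ((hasDerivAt_id t).smul_const d).const_add x
    have h2 : HasDerivAt (fun s : ℝ => φ (x + s • d)) (inner ℝ (g (x + t • d)) d) t := by
      simpa [Function.comp_def] using (hφ (x + t • d)).hasFDerivAt.comp_hasDerivAt t h1
    have h3 := (h2.sub ((hasDerivAt_id t).mul_const (inner ℝ (g x) d))).sub
      ((((hasDerivAt_id t).pow 2).const_mul (1 / 2 : ℝ)).mul_const (inner ℝ d (R d)))
    exact h3.congr_deriv (by simp)
  have hmono : MonotoneOn f (Set.Icc 0 1) := by
    refine monotoneOn_of_deriv_nonneg (convex_Icc 0 1)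
      (fun t _ => (hder t).continuousAt.continuousWithinAt)
      (fun t _ => (hder t).differentiableAt.differentiableWithinAt) fun t ht => ?_
    rw [interior_Icc] at ht
    rw [(hder t).deriv]
    -- At the increment `t • d` the hypothesis is `t` times the desired sign condition on the
    -- derivative, and `t > 0` in the interior.
    have h := hR x (t • d)
    simp only [map_smul, inner_smul_left, inner_smul_right, inner_sub_right,
      RCLike.conj_to_real] at h
    rw [real_inner_comm d (g (x + t • d)), real_inner_comm d (g x)]
    refine le_of_mul_le_mul_left ?_ ht.1
    linarith
  have := hmono (Set.left_mem_Icc.2 zero_le_one) (Set.right_mem_Icc.2 zero_le_one) zero_le_one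
  simp only [f] at this
  norm_num at this ⊢
  linarith

end Analysis

/-! ### Algebra of the seminorms of positive operators -/

section SqNorm

variable {E : Type*} [NormedAddCommGroup E] [InnerProductSpace ℝ E]

theorem inner_symm_of_isPositive {G : E →L[ℝ] E} (hG : G.IsPositive) (x y : E) :
    inner ℝ x (G y) = inner ℝ y (G x) := by
  rw [← hG.inner_left_eq_inner_right, real_inner_comm]

theorem sqNorm_nonneg {G : E →L[ℝ] E} (hG : G.IsPositive) (z : E) : 0 ≤ sqNorm G z :=
  hG.inner_nonneg_right z

theorem sqNorm_add_left (G G' : E →L[ℝ] E) (z : E) :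
    sqNorm (G + G') z = sqNorm G z + sqNorm G' z := by
  simp [sqNorm, inner_add_right]

theorem sqNorm_sub_left (G G' : E →L[ℝ] E) (z : E) :
    sqNorm (G - G') z = sqNorm G z - sqNorm G' z := by
  simp [sqNorm, inner_sub_right]

theorem sqNorm_smul_left (r : ℝ) (G : E →L[ℝ] E) (z : E) :
    sqNorm (r • G) z = r * sqNorm G z := by
  simp [sqNorm, inner_smul_right]

theorem sqNorm_neg (G : E →L[ℝ] E) (z : E) : sqNorm G (-z) = sqNorm G z := by
  simp [sqNorm]

theorem sqNorm_sub_comm (G : E →L[ℝ] E) (y z : E) : sqNorm G (y - z) = sqNorm G (z - y) := by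
  rw [← sqNorm_neg, neg_sub]

theorem sqNorm_add {G : E →L[ℝ] E} (hG : G.IsPositive) (x y : E) :
    sqNorm G (x + y) = sqNorm G x + 2 * inner ℝ x (G y) + sqNorm G y := by
  simp only [sqNorm, map_add, inner_add_left, inner_add_right]
  rw [inner_symm_of_isPositive hG y x]
  ring

theorem sqNorm_sub {G : E →L[ℝ] E} (hG : G.IsPositive) (x y : E) :
    sqNorm G (x - y) = sqNorm G x - 2 * inner ℝ x (G y) + sqNorm G y := by
  simp only [sqNorm, map_sub, inner_sub_left, inner_sub_right]
  rw [inner_symm_of_isPositive hG y x]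
  ring

theorem sqNorm_add_smul {G : E →L[ℝ] E} (hG : G.IsPositive) (x y : E) (t : ℝ) :
    sqNorm G (x + t • y) = sqNorm G x + t * (2 * inner ℝ y (G x)) + t ^ 2 * sqNorm G y := by
  rw [sqNorm_add hG]
  simp only [sqNorm, map_smul, inner_smul_left, inner_smul_right, RCLike.conj_to_real]
  rw [inner_symm_of_isPositive hG x y]
  ring

theorem inner_le_half_sqNorm {G : E →L[ℝ] E} (hG : G.IsPositive) (x y : E) :
    inner ℝ x (G y) ≤ 1 / 2 * sqNorm G x + 1 / 2 * sqNorm G y := by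
  have := sqNorm_nonneg hG (x - y)
  rw [sqNorm_sub hG] at this
  linarith

theorem sqNorm_sub_le {G : E →L[ℝ] E} (hG : G.IsPositive) (x y : E) :
    sqNorm G (x - y) ≤ 2 * sqNorm G x + 2 * sqNorm G y := by
  have := sqNorm_nonneg hG (x + y)
  rw [sqNorm_add hG] at this
  rw [sqNorm_sub hG]
  linarith

/-- The three-point identity. -/
theorem inner_three_point {G : E →L[ℝ] E} (hG : G.IsPositive) (x y z : E) :
    inner ℝ (z - y) (G (y - x)) =
      1 / 2 * (sqNorm G (x - z) - sqNorm G (y - z) - sqNorm G (y - x)) := by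
  have h : x - z = (y - z) - (y - x) := by abel
  rw [h, sqNorm_sub hG (y - z) (y - x), ← neg_sub y z, inner_neg_left]
  ring

end SqNorm

/-! ### First-order optimality for extended-real convex functions -/

section Optimality

variable {E : Type*} [NormedAddCommGroup E] [InnerProductSpace ℝ E]

theorem ClosedProperConvex.coe_toReal {f : E → EReal} (hf : ClosedProperConvex f) {x : E}
    (hx : x ∈ dom f) : ((f x).toReal : EReal) = f x :=
  EReal.coe_toReal (ne_of_lt hx) (hf.ne_bot x)

theorem ClosedProperConvex.mem_dom_of_isMinOn {f : E → EReal} (hf : ClosedProperConvex f)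
    {h : E → ℝ} {x : E} (hx : ∀ y, f x + (h x : EReal) ≤ f y + (h y : EReal)) : x ∈ dom f := by
  obtain ⟨y, hy⟩ := hf.dom_nonempty
  have h1 := hx y
  rw [← hf.coe_toReal hy, ← EReal.coe_add] at h1
  by_contra hc
  have h2 : f x = ⊤ := by simpa [dom] using hc
  rw [h2, EReal.top_add_coe] at h1
  exact absurd (top_le_iff.1 h1) (EReal.coe_ne_top _)

/-- First-order optimality for the sum of a convex function and a function that is quadratic
along the segment under consideration. -/
theorem ClosedProperConvex.toReal_le_of_isMinOn {f : E → EReal} (hf : ClosedProperConvex f)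
    {h : E → ℝ} {x : E} (hx : ∀ y, f x + (h x : EReal) ≤ f y + (h y : EReal)) {y : E}
    (hy : y ∈ dom f) {l C : ℝ}
    (hq : ∀ t : ℝ, h (x + t • (y - x)) = h x + t * l + t ^ 2 * C) :
    (f x).toReal ≤ (f y).toReal + l := by
  have hxd := hf.mem_dom_of_isMinOn hx
  -- Minimality at `x + t • (y - x)` and convexity of `f` give this after division by `t`; the
  -- curvature `C` then disappears as `t` tends to `0`.
  have key : ∀ t ∈ Set.Ioo (0 : ℝ) 1, (f x).toReal - (f y).toReal - l ≤ t * C := by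
    intro t ht
    have hconv := hf.convex_epigraph
      (show (x, (f x).toReal) ∈ {y : E × ℝ | f y.1 ≤ (y.2 : EReal)} from
        (hf.coe_toReal hxd).ge)
      (show (y, (f y).toReal) ∈ {y : E × ℝ | f y.1 ≤ (y.2 : EReal)} from
        (hf.coe_toReal hy).ge)
      (sub_nonneg.2 ht.2.le) ht.1.le (sub_add_cancel 1 t)
    have hpt : (1 - t) • x + t • y = x + t • (y - x) := by
      rw [sub_smul, one_smul, smul_sub]
      abel
    simp only [Prod.smul_mk, Prod.mk_add_mk, Set.mem_ofPred_eq, hpt, smul_eq_mul] at hconv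
    have h1 := (hx (x + t • (y - x))).trans (add_le_add_left hconv _)
    rw [← hf.coe_toReal hxd, ← EReal.coe_add, ← EReal.coe_add, EReal.coe_le_coe_iff, hq,
      EReal.toReal_coe] at h1
    refine le_of_mul_le_mul_left ?_ ht.1
    linarith
  have hlim : Filter.Tendsto (fun t : ℝ => t * C) (nhdsWithin 0 (Set.Ioi 0)) (nhds 0) := by
    have : Filter.Tendsto (fun t : ℝ => t * C) (nhds 0) (nhds (0 * C)) :=
      (continuous_id.mul continuous_const).tendsto 0
    rw [zero_mul] at this
    exact this.mono_left nhdsWithin_le_nhds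
  have := ge_of_tendsto hlim (Filter.mem_of_superset (Ioo_mem_nhdsGT zero_lt_one) key)
  linarith

end Optimality

/-! ### Block operators on the product space -/

section Blocks

theorem pair_sub {U V : Type*} [NormedAddCommGroup U] [NormedAddCommGroup V] (u u' : U) (v v' : V) :
    pair u v - pair u' v' = pair (u - u') (v - v') := rfl

theorem pair_add {U V : Type*} [NormedAddCommGroup U] [NormedAddCommGroup V] (u u' : U) (v v' : V) :
    pair u v + pair u' v' = pair (u + u') (v + v') := rfl

variable {U V : Type*} [NormedAddCommGroup U] [InnerProductSpace ℝ U]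
  [NormedAddCommGroup V] [InnerProductSpace ℝ V]

theorem pair_add_smul (u d : U) (v e : V) (t : ℝ) :
    pair (u + t • d) (v + t • e) = pair u v + t • pair d e := rfl

theorem inner_pair (u u' : U) (v v' : V) :
    inner ℝ (pair u v) (pair u' v') = inner ℝ u u' + inner ℝ v v' := rfl

theorem diag_pair (D₁ : U →L[ℝ] U) (D₂ : V →L[ℝ] V) (u : U) (v : V) :
    diag D₁ D₂ (pair u v) = pair (D₁ u) (D₂ v) := by
  simp [diag, inl, inr, fst, snd, ← WithLp.toLp_add]

theorem sqNorm_diag (D₁ : U →L[ℝ] U) (D₂ : V →L[ℝ] V) (u : U) (v : V) :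
    sqNorm (diag D₁ D₂) (pair u v) = sqNorm D₁ u + sqNorm D₂ v := by
  rw [sqNorm, diag_pair, inner_pair, sqNorm, sqNorm]

theorem diag_isPositive {D₁ : U →L[ℝ] U} {D₂ : V →L[ℝ] V} (h₁ : D₁.IsPositive)
    (h₂ : D₂.IsPositive) : (diag D₁ D₂).IsPositive := by
  refine ⟨fun x y => ?_, fun x => ?_⟩
  · change inner ℝ (diag D₁ D₂ (pair x.fst x.snd)) (pair y.fst y.snd) =
      inner ℝ (pair x.fst x.snd) (diag D₁ D₂ (pair y.fst y.snd))
    rw [diag_pair, diag_pair, inner_pair, inner_pair, h₁.inner_left_eq_inner_right,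
      h₂.inner_left_eq_inner_right]
  · change 0 ≤ inner ℝ (diag D₁ D₂ (pair x.fst x.snd)) (pair x.fst x.snd)
    rw [diag_pair, inner_pair]
    exact add_nonneg (h₁.inner_nonneg_left _) (h₂.inner_nonneg_left _)

theorem inner_block12 (W : WithLp 2 (U × V) →L[ℝ] WithLp 2 (U × V)) (u : U) (v : V) :
    inner ℝ u (block12 W v) = inner ℝ (pair u 0) (W (pair 0 v)) := by
  simp [block12, fst, inr]

theorem inner_block22 (W : WithLp 2 (U × V) →L[ℝ] WithLp 2 (U × V)) (v v' : V) :
    inner ℝ v (block22 W v') = inner ℝ (pair 0 v) (W (pair 0 v')) := by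
  simp [block22, snd, inr]

theorem sqNorm_block22 (W : WithLp 2 (U × V) →L[ℝ] WithLp 2 (U × V)) (v : V) :
    sqNorm (block22 W) v = sqNorm W (pair 0 v) :=
  inner_block22 W v v

/-- Constant sequences suffice. This is how the hypotheses on generalized Hessians reach the
derivatives supplied by Rademacher's theorem. -/
theorem fderiv_gradient_mem_clarkeHessian {E : Type*} [NormedAddCommGroup E]
    [InnerProductSpace ℝ E] [FiniteDimensional ℝ E] {φ : E → ℝ} {y : E}
    (hy : DifferentiableAt ℝ (gradient φ) y) :
    fderiv ℝ (gradient φ) y ∈ clarkeHessian φ y :=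
  subset_convexHull ℝ _ ⟨fun _ => y, tendsto_const_nhds, fun _ => hy, tendsto_const_nhds⟩

theorem Data.H_isPositive {X : Type*} [NormedAddCommGroup X] [InnerProductSpace ℝ X]
    {P : Data U V X} (hD₁ : P.D₁.IsPositive) (hD₂ : P.D₂.IsPositive) : P.H.IsPositive :=
  diag_isPositive hD₁ hD₂

end Blocks

theorem norm_add_smul_sq {X : Type*} [NormedAddCommGroup X] [InnerProductSpace ℝ X] (r s : X)
    (t : ℝ) : ‖r + t • s‖ ^ 2 = ‖r‖ ^ 2 + t * (2 * inner ℝ r s) + t ^ 2 * ‖s‖ ^ 2 := by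
  rw [norm_add_sq_real, inner_smul_right, norm_smul, mul_pow, Real.norm_eq_abs, sq_abs]
  ring

/-! ### Consequences of the Hessian bounds for `φ` and its majorization -/

namespace Data

open ContinuousLinearMap (adjoint)

variable {U V X : Type*} [NormedAddCommGroup U] [InnerProductSpace ℝ U] [FiniteDimensional ℝ U]
  [NormedAddCommGroup V] [InnerProductSpace ℝ V] [FiniteDimensional ℝ V]
  [NormedAddCommGroup X] [InnerProductSpace ℝ X]
  {P : Data U V X}

theorem lower_quadratic_bound (hφ : Differentiable ℝ P.φ)
    (hlip : ∃ L : NNReal, LipschitzWith L (gradient P.φ)) (hb : P.HessianBounds)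
    (x y : WithLp 2 (U × V)) :
    P.φ x + inner ℝ (gradient P.φ x) (y - x) + 1 / 2 * sqNorm P.Q (y - x) ≤ P.φ y := by
  obtain ⟨L, hL⟩ := hlip
  have := add_inner_add_le_of_le_inner_sub (fun x => (hφ x).hasGradientAt) (R := P.Q)
    (fun x d => le_inner_sub_of_le_inner_fderiv hL d d (fun z hz => by
      have := (hb z _ (fderiv_gradient_mem_clarkeHessian hz)).1.inner_nonneg_right d
      simpa [inner_sub_right] using this) x) x (y - x)
  simpa [sqNorm] using this

theorem upper_quadratic_bound (hφ : Differentiable ℝ P.φ)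
    (hlip : ∃ L : NNReal, LipschitzWith L (gradient P.φ)) (hb : P.HessianBounds)
    (x y : WithLp 2 (U × V)) :
    P.φ y ≤ P.φ x + inner ℝ (gradient P.φ x) (y - x) + 1 / 2 * sqNorm (P.Q + P.H) (y - x) := by
  obtain ⟨L, hL⟩ := hlip
  have hg : ∀ x, HasGradientAt (-P.φ) (-gradient P.φ x) x := fun x => by
    have := (hφ x).hasGradientAt.hasFDerivAt.neg
    rw [hasGradientAt_iff_hasFDerivAt, map_neg]
    exact this
  -- The upper bound for `φ` is the lower bound for `-φ`; the sign is moved onto the test vector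
  -- `-d`, so that the Lipschitz map stays the gradient of `φ`.
  have := add_inner_add_le_of_le_inner_sub hg (R := -(P.Q + P.H))
    (fun x d => by
      have h := le_inner_sub_of_le_inner_fderiv hL (-d) d (m := -inner ℝ d ((P.Q + P.H) d))
        (fun z hz => by
          have := (hb z _ (fderiv_gradient_mem_clarkeHessian hz)).2.inner_nonneg_right d
          simp only [sub_apply, inner_sub_right] at this
          rw [inner_neg_left]
          linarith) x
      simp only [neg_apply, inner_neg_right]
      refine h.trans_eq ?_
      simp only [inner_neg_left, inner_sub_right, inner_neg_right]) x (y - x)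
  simp only [Pi.neg_apply, inner_neg_left, neg_apply, inner_neg_right,
    add_sub_cancel] at this
  simp only [sqNorm]
  linarith

/-- The lower quadratic bound is used from `w` to `w₁` and from `w₀` to `w`, the upper one from `w₀`
to `w₁`; in the sum all values of `φ` cancel. -/
theorem inner_gradient_le (hφ : Differentiable ℝ P.φ)
    (hlip : ∃ L : NNReal, LipschitzWith L (gradient P.φ)) (hb : P.HessianBounds)
    (w w₀ w₁ : WithLp 2 (U × V)) :
    inner ℝ (w₁ - w) (gradient P.φ w) ≤ inner ℝ (gradient P.φ w₀) (w₁ - w) +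
      1 / 2 * (sqNorm P.Q (w₁ - w₀) + sqNorm P.H (w₁ - w₀)) - 1 / 2 * sqNorm P.Q (w₁ - w) -
      1 / 2 * sqNorm P.Q (w₀ - w) := by
  have h1 := lower_quadratic_bound hφ hlip hb w w₁
  have h2 := lower_quadratic_bound hφ hlip hb w₀ w
  have h3 := upper_quadratic_bound hφ hlip hb w₀ w₁
  rw [sqNorm_sub_comm, inner_sub_right] at h2
  rw [sqNorm_add_left, inner_sub_right] at h3
  rw [real_inner_comm, inner_sub_right (gradient P.φ w₀)]
  linarith

/-- The change of `∇_v φ`, compared with that of its majorization, tested against `z`. -/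
theorem neg_inner_gradient_sub_le (hlip : ∃ L : NNReal, LipschitzWith L (gradient P.φ))
    (hb : P.HessianBounds) (hcross : P.CrossControl)
    (w : WithLp 2 (U × V)) (a : U) (b z : V) :
    -inner ℝ (pair 0 z) (gradient P.φ (w + pair a b) - gradient P.φ w) +
        inner ℝ (pair 0 z) (P.Q (pair a b)) + inner ℝ z (P.D₂ b) ≤
      P.η / 2 * (sqNorm P.D₁ a + sqNorm P.D₂ z) +
        (1 / 2 * sqNorm P.D₂ z + 1 / 2 * sqNorm P.D₂ b) := by
  obtain ⟨L, hL⟩ := hlip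
  have key := le_inner_sub_of_le_inner_fderiv hL (pair 0 z) (pair a b)
    (m := inner ℝ (pair 0 z) (P.Q (pair a b)) + inner ℝ z (P.D₂ b) -
      (P.η / 2 * (sqNorm P.D₁ a + sqNorm P.D₂ z) +
        (1 / 2 * sqNorm P.D₂ z + 1 / 2 * sqNorm P.D₂ b)))
    (fun y hy => by
      set W := fderiv ℝ (gradient P.φ) y with hW
      have hmem := fderiv_gradient_mem_clarkeHessian hy
      obtain ⟨h1, h2⟩ := hb y W hmem
      have hc := (abs_le.1 (hcross y W hmem a z)).1
      rw [sub_apply, inner_sub_right, inner_block12, inner_block12] at hc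
      -- The cross control concerns the upper right block; symmetry of `W - Q` transfers it to the
      -- lower left block, which acts on `a`.
      have hM := inner_symm_of_isPositive h1 (pair a 0) (pair 0 z)
      -- On the `V`-block, `W - Q = H - N` with `N = Q + H - W`. Young's inequality is applied to
      -- `N`, and `N ⪯ H` turns its seminorms into those of `D₂`.
      have hN := inner_le_half_sqNorm h2 (pair 0 z) (pair 0 b)
      have hz := sqNorm_nonneg h1 (pair 0 z)
      have hb' := sqNorm_nonneg h1 (pair 0 b)
      have hab : pair a b = pair a 0 + pair (0 : U) b := by rw [pair_add]; simp
      have hHz : sqNorm P.H (pair 0 z) = sqNorm P.D₂ z := by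
        rw [H, sqNorm_diag]
        simp [sqNorm]
      have hHb : sqNorm P.H (pair 0 b) = sqNorm P.D₂ b := by
        rw [H, sqNorm_diag]
        simp [sqNorm]
      have hHzb : inner ℝ (pair 0 z) (P.H (pair 0 b)) = inner ℝ z (P.D₂ b) := by
        simp [H, diag_pair]
      simp only [sqNorm_sub_left, sqNorm_add_left, sub_apply,
        add_apply, inner_sub_right, inner_add_right] at hM hN hz hb'
      rw [hab]
      simp only [map_add, inner_add_right]
      linarith) w
  linarith

theorem φhat_add_smul (hG : (P.Q + P.H).IsPositive) (w w' e : WithLp 2 (U × V)) (t : ℝ) :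
    P.φhat (w + t • e) w' = P.φhat w w' +
      t * (inner ℝ (gradient P.φ w') e + inner ℝ e ((P.Q + P.H) (w - w'))) +
      t ^ 2 * (1 / 2 * sqNorm (P.Q + P.H) e) := by
  have h : w + t • e - w' = (w - w') + t • e := by abel
  simp only [φhat]
  rw [sqNorm_sub_comm _ w' (w + t • e), h, sqNorm_add_smul hG, sqNorm_sub_comm _ w' w,
    inner_add_right, inner_smul_right]
  ring

variable [FiniteDimensional ℝ X]

theorem res_add_smul_left (u d : U) (v : V) (t : ℝ) :
    P.res (u + t • d) v = P.res u v + t • adjoint P.A d := by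
  simp only [res, map_add, map_smul]
  abel

theorem res_add_smul_right (u : U) (v d : V) (t : ℝ) :
    P.res u (v + t • d) = P.res u v + t • adjoint P.B d := by
  simp only [res, map_add, map_smul]
  abel

/-! ### Variational inequalities of the two subproblems -/

section Iterates

variable {us : ℕ → U} {vs : ℕ → V} {xs : ℕ → X}

/-- The smooth part of the objective of the `u`-step. -/
def smoothU (P : Data U V X) (u₀ : U) (v₀ : V) (x₀ : X) (u : U) : ℝ :=
  (P.q v₀).toReal + (P.φhat (pair u v₀) (pair u₀ v₀) + inner ℝ x₀ (P.res u v₀) +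
    P.σ / 2 * ‖P.res u v₀‖ ^ 2) + 1 / 2 * sqNorm P.S (u - u₀)

/-- The smooth part of the objective of the `v`-step. -/
def smoothV (P : Data U V X) (u₀ : U) (v₀ : V) (x₀ : X) (u₁ : U) (v : V) : ℝ :=
  (P.p u₁).toReal + (P.φhat (pair u₁ v) (pair u₀ v₀) + inner ℝ x₀ (P.res u₁ v) +
    P.σ / 2 * ‖P.res u₁ v‖ ^ 2) + 1 / 2 * sqNorm P.T (v - v₀)

theorem IsIterates.isMinOn_u (hq : ClosedProperConvex P.q) (hit : P.IsIterates us vs xs) {k : ℕ}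
    (hv : vs k ∈ dom P.q) (u : U) :
    P.p (us (k + 1)) + (P.smoothU (us k) (vs k) (xs k) (us (k + 1)) : EReal) ≤
      P.p u + (P.smoothU (us k) (vs k) (xs k) u : EReal) := by
  have := hit.step_u k (Set.mem_univ u)
  simp only [augLagrangian, Set.mem_ofPred_eq] at this
  rw [← hq.coe_toReal hv] at this
  simp only [smoothU, EReal.coe_add] at this ⊢
  simpa only [add_assoc] using this

theorem IsIterates.isMinOn_v (hp : ClosedProperConvex P.p) (hit : P.IsIterates us vs xs) {k : ℕ}
    (hu : us (k + 1) ∈ dom P.p) (v : V) :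
    P.q (vs (k + 1)) +
        (P.smoothV (us k) (vs k) (xs k) (us (k + 1)) (vs (k + 1)) : EReal) ≤
      P.q v + (P.smoothV (us k) (vs k) (xs k) (us (k + 1)) v : EReal) := by
  have := hit.step_v k (Set.mem_univ v)
  simp only [augLagrangian, Set.mem_ofPred_eq] at this
  rw [← hp.coe_toReal hu, add_comm _ (P.q _), add_comm _ (P.q _)] at this
  simp only [smoothV, EReal.coe_add] at this ⊢
  simpa only [add_assoc] using this

theorem IsIterates.mem_dom (hp : ClosedProperConvex P.p) (hq : ClosedProperConvex P.q)
    (hit : P.IsIterates us vs xs) (k : ℕ) : us k ∈ dom P.p ∧ vs k ∈ dom P.q := by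
  induction k with
  | zero => exact ⟨hit.init_u, hit.init_v⟩
  | succ k ih =>
    have hu := hp.mem_dom_of_isMinOn (hit.isMinOn_u hq ih.2)
    exact ⟨hu, hq.mem_dom_of_isMinOn (hit.isMinOn_v hp hu)⟩

/-- The linear coefficient of the smooth part along the segment towards `u`. Both `Q` and the
residual are evaluated with the old `v`, the source of the mismatch terms later on. -/
theorem IsIterates.toReal_p_le (hp : ClosedProperConvex P.p) (hq : ClosedProperConvex P.q)
    (hQ : P.Q.IsPositive) (hD₁ : P.D₁.IsPositive) (hD₂ : P.D₂.IsPositive) (hS : P.S.IsPositive)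
    (hit : P.IsIterates us vs xs) (k : ℕ) {u : U} (hu : u ∈ dom P.p) :
    (P.p (us (k + 1))).toReal ≤ (P.p u).toReal +
      (inner ℝ (gradient P.φ (pair (us k) (vs k))) (pair (u - us (k + 1)) 0) +
        inner ℝ (pair (u - us (k + 1)) 0) (P.Q (pair (us (k + 1) - us k) 0)) +
        inner ℝ (u - us (k + 1)) (P.D₁ (us (k + 1) - us k)) +
        inner ℝ (u - us (k + 1)) (P.S (us (k + 1) - us k)) +
        inner ℝ (xs k) (adjoint P.A (u - us (k + 1))) +
        P.σ * inner ℝ (P.res (us (k + 1)) (vs k)) (adjoint P.A (u - us (k + 1)))) := by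
  have hG : (P.Q + P.H).IsPositive := hQ.add (H_isPositive hD₁ hD₂)
  refine hp.toReal_le_of_isMinOn (hit.isMinOn_u hq (hit.mem_dom hp hq k).2) hu
    (C := 1 / 2 * sqNorm (P.Q + P.H) (pair (u - us (k + 1)) 0) +
      P.σ / 2 * ‖adjoint P.A (u - us (k + 1))‖ ^ 2 + 1 / 2 * sqNorm P.S (u - us (k + 1)))
    fun t => ?_
  set d := u - us (k + 1)
  have h1 : pair (us (k + 1) + t • d) (vs k) = pair (us (k + 1)) (vs k) + t • pair d 0 := by
    rw [← pair_add_smul, smul_zero, add_zero]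
  have h2 : us (k + 1) + t • d - us k = (us (k + 1) - us k) + t • d := by abel
  have h3 : inner ℝ (pair d 0) (P.H (pair (us (k + 1) - us k) (0 : V))) =
      inner ℝ d (P.D₁ (us (k + 1) - us k)) := by
    simp [H, diag_pair]
  simp only [smoothU]
  rw [h1, φhat_add_smul hG, res_add_smul_left, norm_add_smul_sq, h2, sqNorm_add_smul hS,
    pair_sub, sub_self, inner_add_right, inner_smul_right, add_apply,
    inner_add_right, h3]
  ring

/-- Here both blocks are already updated, so the multiplier and penalty terms merge into `x̃`. -/
theorem IsIterates.toReal_q_le (hp : ClosedProperConvex P.p) (hq : ClosedProperConvex P.q)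
    (hQ : P.Q.IsPositive) (hD₁ : P.D₁.IsPositive) (hD₂ : P.D₂.IsPositive) (hT : P.T.IsPositive)
    (hit : P.IsIterates us vs xs) (k : ℕ) {v : V} (hv : v ∈ dom P.q) :
    (P.q (vs (k + 1))).toReal ≤ (P.q v).toReal +
      (inner ℝ (gradient P.φ (pair (us k) (vs k))) (pair 0 (v - vs (k + 1))) +
        inner ℝ (pair 0 (v - vs (k + 1))) (P.Q (pair (us (k + 1) - us k) (vs (k + 1) - vs k))) +
        inner ℝ (v - vs (k + 1)) (P.D₂ (vs (k + 1) - vs k)) +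
        inner ℝ (v - vs (k + 1)) (P.T (vs (k + 1) - vs k)) +
        inner ℝ (P.xtildeSucc us vs xs k) (adjoint P.B (v - vs (k + 1)))) := by
  have hG : (P.Q + P.H).IsPositive := hQ.add (H_isPositive hD₁ hD₂)
  refine hq.toReal_le_of_isMinOn (hit.isMinOn_v hp (hit.mem_dom hp hq (k + 1)).1) hv
    (C := 1 / 2 * sqNorm (P.Q + P.H) (pair 0 (v - vs (k + 1))) +
      P.σ / 2 * ‖adjoint P.B (v - vs (k + 1))‖ ^ 2 + 1 / 2 * sqNorm P.T (v - vs (k + 1)))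
    fun t => ?_
  set d := v - vs (k + 1)
  have h1 : pair (us (k + 1)) (vs (k + 1) + t • d) =
      pair (us (k + 1)) (vs (k + 1)) + t • pair 0 d := by
    rw [← pair_add_smul, smul_zero, add_zero]
  have h2 : vs (k + 1) + t • d - vs k = (vs (k + 1) - vs k) + t • d := by abel
  have h3 : inner ℝ (pair 0 d) (P.H (pair (us (k + 1) - us k) (vs (k + 1) - vs k))) =
      inner ℝ d (P.D₂ (vs (k + 1) - vs k)) := by
    simp [H, diag_pair]
  simp only [smoothV, xtildeSucc]
  rw [h1, φhat_add_smul hG, res_add_smul_right, norm_add_smul_sq, h2, sqNorm_add_smul hT,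
    pair_sub, inner_add_right, inner_smul_right, add_apply,
    inner_add_right, h3, inner_add_left, inner_smul_left, RCLike.conj_to_real]
  ring

end Iterates

end Data

/-! ### Identities and estimates for multipliers and residuals -/

theorem multiplier_identity {X : Type*} [NormedAddCommGroup X] [InnerProductSpace ℝ X]
    {σ τ : ℝ} (hσ : 0 < σ) (hτ : 0 < τ) (x₀ x r ρ δ e : X) :
    inner ℝ x₀ ρ + σ * inner ℝ (r - e) ρ + inner ℝ (x₀ + σ • r) δ - inner ℝ x ρ - inner ℝ x δ -
        inner ℝ (x₀ + σ • r - x) (r + ρ + δ) =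
      1 / 2 * ((τ * σ)⁻¹ * ‖x₀ - x‖ ^ 2 - (τ * σ)⁻¹ * ‖x₀ + (τ * σ) • r - x‖ ^ 2) +
        1 / 2 * (τ - 1) * σ * ‖r‖ ^ 2 +
        1 / 2 * (σ * ‖r + ρ - e‖ ^ 2 - σ * ‖r + ρ‖ ^ 2 - σ * ‖r - e‖ ^ 2) := by
  have h : x₀ + (τ * σ) • r - x = (x₀ - x) + (τ * σ) • r := by abel
  -- Without the mismatch `-σ⟨e, ρ⟩` the left side is `-⟨x₀ + σ r - x, r⟩`, which telescopes under
  -- the update of `x`; the mismatch is a four-term polarization giving the residual squares.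
  rw [h, norm_add_smul_sq, norm_sub_sq_real (r + ρ) e, norm_sub_sq_real r e]
  simp only [inner_add_left, inner_add_right, inner_sub_left, inner_smul_left,
    RCLike.conj_to_real]
  rw [real_inner_self_eq_norm_sq, real_inner_comm ρ e]
  field_simp
  ring

/-- The estimate of the residual terms for an arbitrary step length. -/
theorem residual_estimate {X : Type*} [NormedAddCommGroup X] [InnerProductSpace ℝ X]
    {σ τ : ℝ} (hσ : 0 < σ) (hτ : 0 < τ) (r s b : X) :
    (1 - τ) * σ * inner ℝ r b - 1 / 2 * σ * ‖b‖ ^ 2 + 1 / 2 * (τ - 2) * σ * ‖s‖ ^ 2 +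
        1 / 2 * (max (1 - τ) (1 - τ⁻¹) * σ * ‖s‖ ^ 2 - max (1 - τ) (1 - τ⁻¹) * σ * ‖r‖ ^ 2) ≤
      -(1 / 2) * (min τ (1 + τ - τ ^ 2) * (σ * ‖b‖ ^ 2) +
        min 1 (1 + τ⁻¹ - τ) * σ * ‖s‖ ^ 2) := by
  have hinv : τ * τ⁻¹ = 1 := mul_inv_cancel₀ hτ.ne'
  have hinv0 : 0 < τ⁻¹ := inv_pos.2 hτ
  rcases le_total τ 1 with h | h
  · have h1 : 1 ≤ τ⁻¹ := (one_le_inv₀ hτ).2 h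
    rw [max_eq_left (by linarith), min_eq_left (by nlinarith), min_eq_left (by linarith)]
    -- Young's inequality with equal weights: `⟨r, b⟩` has coefficient `(1 - τ)σ ≥ 0`.
    have := mul_nonneg (mul_nonneg (sub_nonneg.2 h) hσ.le) (sq_nonneg ‖r - b‖)
    rw [norm_sub_sq_real] at this
    linarith
  · have h1 : τ⁻¹ ≤ 1 := inv_le_one_of_one_le₀ h
    rw [max_eq_right (by linarith), min_eq_right (by nlinarith), min_eq_right (by linarith)]
    -- The coefficient of `⟨r, b⟩` is now nonpositive, whence `r + τ • b`. The weight `τ` makes the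
    -- coefficient of `‖r‖²` equal to `1 - τ⁻¹`, the one in the maximum, so that it telescopes.
    have := mul_nonneg (mul_nonneg (mul_nonneg (sub_nonneg.2 h) hσ.le) hinv0.le)
      (sq_nonneg ‖r + τ • b‖)
    rw [norm_add_smul_sq] at this
    have e : (τ - 1) * σ * τ⁻¹ * (‖r‖ ^ 2 + τ * (2 * inner ℝ r b) + τ ^ 2 * ‖b‖ ^ 2) =
        (1 - τ⁻¹) * σ * ‖r‖ ^ 2 + (τ - 1) * σ * (2 * inner ℝ r b) +
          (τ ^ 2 - τ) * σ * ‖b‖ ^ 2 := by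
      field_simp
    rw [e] at this
    linarith

/-! ### The one-step estimate and the two inequalities -/

namespace Data

open ContinuousLinearMap (adjoint)

variable {U V X : Type*} [NormedAddCommGroup U] [InnerProductSpace ℝ U] [FiniteDimensional ℝ U]
  [NormedAddCommGroup V] [InnerProductSpace ℝ V] [FiniteDimensional ℝ V]
  [NormedAddCommGroup X] [InnerProductSpace ℝ X] [FiniteDimensional ℝ X]
  {P : Data U V X} {us : ℕ → U} {vs : ℕ → V} {xs : ℕ → X}

/-- The variational-inequality gap at points of the domain, as a real number. -/
def viGapReal (P : Data U V X) (us : ℕ → U) (vs : ℕ → V) (xs : ℕ → X) (k : ℕ) (u : U) (v : V)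
    (x : X) : ℝ :=
  ((P.p (us (k + 1))).toReal + (P.q (vs (k + 1))).toReal) - ((P.p u).toReal + (P.q v).toReal) +
    (inner ℝ (pair (us (k + 1)) (vs (k + 1)) - pair u v) (gradient P.φ (pair u v)) +
      inner ℝ (us (k + 1) - u) (P.A x) + inner ℝ (vs (k + 1) - v) (P.B x) -
      inner ℝ (P.xtildeSucc us vs xs k - x) (P.res u v))

/-- Off the domain the gap is `⊥` and nothing has to be shown; on it all values are finite because
the iterates remain in the domains. -/
theorem viGapSucc_add_le (hp : ClosedProperConvex P.p) (hq : ClosedProperConvex P.q)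
    (hit : P.IsIterates us vs xs) {k : ℕ} {u : U} {v : V} {x : X} {t s : ℝ}
    (h : u ∈ dom P.p → v ∈ dom P.q → P.viGapReal us vs xs k u v x + t ≤ s) :
    P.viGapSucc us vs xs k u v x + (t : EReal) ≤ (s : EReal) := by
  by_cases hu : u ∈ dom P.p
  · by_cases hv : v ∈ dom P.q
    · obtain ⟨h1, h2⟩ := hit.mem_dom hp hq (k + 1)
      have := h hu hv
      simp only [viGapSucc]
      rw [← hp.coe_toReal hu, ← hq.coe_toReal hv, ← hp.coe_toReal h1, ← hq.coe_toReal h2]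
      exact_mod_cast this
    · have hv' : P.q v = ⊤ := by simpa [dom] using hv
      simp only [viGapSucc]
      rw [hv', EReal.add_top_of_ne_bot (hp.ne_bot u), EReal.sub_top, EReal.bot_add, EReal.bot_add]
      exact bot_le
  · have hu' : P.p u = ⊤ := by simpa [dom] using hu
    simp only [viGapSucc]
    rw [hu', EReal.top_add_of_ne_bot (hq.ne_bot v), EReal.sub_top, EReal.bot_add, EReal.bot_add]
    exact bot_le

/-- The common source of (i) and (ii). The `Q`-cross term is kept exact because the two parts treat
it differently. -/
theorem viGapReal_add_le (hp : ClosedProperConvex P.p) (hq : ClosedProperConvex P.q)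
    (hφ : Differentiable ℝ P.φ) (hlip : ∃ L : NNReal, LipschitzWith L (gradient P.φ))
    (hQ : P.Q.IsPositive) (hD₁ : P.D₁.IsPositive) (hD₂ : P.D₂.IsPositive)
    (hb : P.HessianBounds) (hσ : 0 < P.σ) (hτ : 0 < P.τ)
    (hS : P.S.IsPositive) (hT : P.T.IsPositive) (hit : P.IsIterates us vs xs) (k : ℕ)
    {u : U} {v : V} (x : X) (hu : u ∈ dom P.p) (hv : v ∈ dom P.q) :
    P.viGapReal us vs xs k u v x +
        1 / 2 * (P.Φ us vs xs (k + 1) u v x - P.Φ us vs xs k u v x) ≤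
      -(1 / 2) * (sqNorm P.S (us (k + 1) - us k) + sqNorm P.T (vs (k + 1) - vs k) +
          P.σ * ‖P.res (us (k + 1)) (vs k)‖ ^ 2 +
          (1 - P.τ) * P.σ * ‖P.res (us (k + 1)) (vs (k + 1))‖ ^ 2) +
        inner ℝ (pair (us (k + 1)) (vs (k + 1)) - pair u v) (P.Q (pair 0 (vs (k + 1) - vs k))) -
        1 / 2 * sqNorm P.Q (pair 0 (vs (k + 1) - vs k)) -
        3 / 4 * sqNorm P.Q (pair (us (k + 1)) (vs (k + 1)) - pair u v) -
        1 / 4 * sqNorm P.Q (pair (us k) (vs k) - pair u v) := by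
  have hpu := hit.toReal_p_le hp hq hQ hD₁ hD₂ hS k hu
  have hqv := hit.toReal_q_le hp hq hQ hD₁ hD₂ hT k hv
  have hgrad := inner_gradient_le hφ hlip hb (pair u v) (pair (us k) (vs k))
    (pair (us (k + 1)) (vs (k + 1)))
  have hxs := hit.step_x k
  simp only [viGapReal, Φ, sqNorm_add_left, sqNorm_block22]
  set u₀ := us k
  set v₀ := vs k
  set u₁ := us (k + 1)
  set v₁ := vs (k + 1)
  set x₀ := xs k
  have tD₁ := inner_three_point hD₁ u₀ u₁ u
  have tS := inner_three_point hS u₀ u₁ u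
  have tD₂ := inner_three_point hD₂ v₀ v₁ v
  have tT := inner_three_point hT v₀ v₁ v
  have tQ := inner_three_point hQ (pair u₀ v₀) (pair u₁ v₁) (pair u v)
  have tQ₂ := inner_three_point hQ (pair (0 : U) v₀) (pair 0 v₁) (pair 0 v)
  simp only [pair_sub, sub_self] at tQ₂
  have hH : sqNorm P.H (pair u₁ v₁ - pair u₀ v₀) =
      sqNorm P.D₁ (u₁ - u₀) + sqNorm P.D₂ (v₁ - v₀) := by
    rw [pair_sub, H, sqNorm_diag]
  have hsplit : pair u v - pair u₁ v₁ = pair (u - u₁) 0 + pair 0 (v - v₁) := by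
    rw [pair_sub, pair_add, add_zero, zero_add]
  have hneg : pair u₁ v₁ - pair u v = -(pair u v - pair u₁ v₁) := by abel
  -- The `u`-step sees the full increment minus its `v`-part; this difference produces the `Q`-cross
  -- term.
  have hΔ : pair (u₁ - u₀) (0 : V) = (pair u₁ v₁ - pair u₀ v₀) - pair 0 (v₁ - v₀) := by
    rw [pair_sub, pair_sub, sub_zero, sub_self]
  have hQterm : inner ℝ (pair (u - u₁) 0) (P.Q (pair (u₁ - u₀) 0)) +
      inner ℝ (pair 0 (v - v₁)) (P.Q (pair (u₁ - u₀) (v₁ - v₀))) =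
      inner ℝ (pair u v - pair u₁ v₁) (P.Q (pair u₁ v₁ - pair u₀ v₀)) +
      inner ℝ (pair u₁ v₁ - pair u v) (P.Q (pair 0 (v₁ - v₀))) +
      inner ℝ (pair 0 (v - v₁)) (P.Q (pair 0 (v₁ - v₀))) := by
    rw [hΔ, hneg, hsplit, ← pair_sub]
    simp only [map_sub, inner_add_left, inner_neg_left, inner_sub_right]
    ring
  have hgterm : inner ℝ (gradient P.φ (pair u₀ v₀)) (pair (u - u₁) 0) +
      inner ℝ (gradient P.φ (pair u₀ v₀)) (pair 0 (v - v₁)) =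
      -inner ℝ (gradient P.φ (pair u₀ v₀)) (pair u₁ v₁ - pair u v) := by
    rw [← inner_add_right, ← hsplit, hneg, inner_neg_right, neg_neg]
  -- With these choices `r - e`, `r + ρ`, `r + ρ - e` and `r + ρ + δ` are the residuals at `(u₁,
  -- v₀)`, `(u, v₁)`, `(u, v₀)` and `(u, v)`.
  have hm := multiplier_identity hσ hτ x₀ x (P.res u₁ v₁) (adjoint P.A (u - u₁))
    (adjoint P.B (v - v₁)) (adjoint P.B (v₁ - v₀))
  have r1 : P.res u₁ v₁ - adjoint P.B (v₁ - v₀) = P.res u₁ v₀ := by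
    simp only [res, map_sub]; abel
  have r2 : P.res u₁ v₁ + adjoint P.A (u - u₁) = P.res u v₁ := by
    simp only [res, map_sub]; abel
  have r3 : P.res u v₁ + adjoint P.B (v - v₁) = P.res u v := by
    simp only [res, map_sub]; abel
  have r4 : P.res u v₁ - adjoint P.B (v₁ - v₀) = P.res u v₀ := by
    simp only [res, map_sub]; abel
  rw [r2, r1, r3, r4, ← hxs] at hm
  have hA : inner ℝ (u₁ - u) (P.A x) = -inner ℝ x (adjoint P.A (u - u₁)) := by
    rw [ContinuousLinearMap.adjoint_inner_right, real_inner_comm, ← neg_sub u u₁, inner_neg_right]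
  have hB : inner ℝ (v₁ - v) (P.B x) = -inner ℝ x (adjoint P.B (v - v₁)) := by
    rw [ContinuousLinearMap.adjoint_inner_right, real_inner_comm, ← neg_sub v v₁, inner_neg_right]
  rw [hA, hB]
  have hxt : P.xtildeSucc us vs xs k = x₀ + P.σ • P.res u₁ v₁ := rfl
  rw [hxt] at hqv ⊢
  linarith

/-- Monotonicity of `∂q` applied to two consecutive `v`-steps. -/
theorem IsIterates.inner_res_le (hp : ClosedProperConvex P.p) (hq : ClosedProperConvex P.q)
    (hlip : ∃ L : NNReal, LipschitzWith L (gradient P.φ))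
    (hQ : P.Q.IsPositive) (hD₁ : P.D₁.IsPositive) (hD₂ : P.D₂.IsPositive)
    (hb : P.HessianBounds) (hcross : P.CrossControl)
    (hT : P.T.IsPositive) (hit : P.IsIterates us vs xs) (k : ℕ) :
    P.σ * inner ℝ (P.res (us (k + 2)) (vs (k + 2))) (adjoint P.B (vs (k + 2) - vs (k + 1))) ≤
      (1 - P.τ) * P.σ *
          inner ℝ (P.res (us (k + 1)) (vs (k + 1))) (adjoint P.B (vs (k + 2) - vs (k + 1))) -
        inner ℝ (pair 0 (vs (k + 2) - vs (k + 1)))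
          (P.Q (pair (us (k + 2)) (vs (k + 2)) - pair (us (k + 1)) (vs (k + 1)))) +
        P.η / 2 * (sqNorm P.D₁ (us (k + 1) - us k) + sqNorm P.D₂ (vs (k + 2) - vs (k + 1))) +
        1 / 2 * sqNorm (P.D₂ + P.T) (vs (k + 1) - vs k) -
        1 / 2 * sqNorm (P.D₂ + P.T) (vs (k + 2) - vs (k + 1)) := by
  -- Each of the two `v`-steps is tested at the other's minimizer, so the values of `q` cancel in
  -- the sum. The factor `1 - τ` arises because consecutive `x̃` differ by `σ` times the new
  -- residual minus `(1 - τ)σ` times the old one.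
  have h1 := hit.toReal_q_le hp hq hQ hD₁ hD₂ hT k (hit.mem_dom hp hq (k + 2)).2
  have h2 := hit.toReal_q_le hp hq hQ hD₁ hD₂ hT (k + 1) (hit.mem_dom hp hq (k + 1)).2
  have hx := hit.step_x k
  have h3 := neg_inner_gradient_sub_le hlip hb hcross (pair (us k) (vs k))
    (us (k + 1) - us k) (vs (k + 1) - vs k) (vs (k + 2) - vs (k + 1))
  have h4 := inner_le_half_sqNorm hT (vs (k + 2) - vs (k + 1)) (vs (k + 1) - vs k)
  simp only [xtildeSucc, add_assoc, Nat.reduceAdd] at h1 h2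
  have hw : pair (us k) (vs k) + pair (us (k + 1) - us k) (vs (k + 1) - vs k) =
      pair (us (k + 1)) (vs (k + 1)) := by
    rw [pair_add, add_sub_cancel, add_sub_cancel]
  have hz : vs (k + 1) - vs (k + 2) = -(vs (k + 2) - vs (k + 1)) := by abel
  have hz' : pair (0 : U) (vs (k + 1) - vs (k + 2)) = -pair 0 (vs (k + 2) - vs (k + 1)) := by
    rw [hz, ← WithLp.toLp_neg, Prod.neg_mk, neg_zero]
  rw [hz', hz] at h2
  rw [hw] at h3
  rw [hx] at h2
  rw [pair_sub]
  simp only [map_neg, inner_neg_left, inner_neg_right, inner_add_left, inner_smul_left,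
    inner_sub_right, RCLike.conj_to_real, sqNorm_add_left] at h1 h2 h3 ⊢
  simp only [sqNorm] at h3 h4 ⊢
  rw [real_inner_comm (gradient P.φ (pair (us k) (vs k))),
    real_inner_comm (gradient P.φ (pair (us (k + 1)) (vs (k + 1))))] at h3
  linarith

theorem viGapReal_add_Φ_le (hp : ClosedProperConvex P.p) (hq : ClosedProperConvex P.q)
    (hφ : Differentiable ℝ P.φ) (hlip : ∃ L : NNReal, LipschitzWith L (gradient P.φ))
    (hQ : P.Q.IsPositive) (hD₁ : P.D₁.IsPositive) (hD₂ : P.D₂.IsPositive)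
    (hb : P.HessianBounds) (hσ : 0 < P.σ) (hτ : 0 < P.τ)
    (hS : P.S.IsPositive) (hT : P.T.IsPositive) (hit : P.IsIterates us vs xs) (k : ℕ)
    {u : U} {v : V} (x : X) (hu : u ∈ dom P.p) (hv : v ∈ dom P.q) :
    P.viGapReal us vs xs k u v x +
        1 / 2 * (P.Φ us vs xs (k + 1) u v x - P.Φ us vs xs k u v x) ≤
      -(1 / 2) * (P.ΘSucc us vs k + P.σ * ‖P.res (us (k + 1)) (vs k)‖ ^ 2 +
        (1 - P.τ) * P.σ * ‖P.res (us (k + 1)) (vs (k + 1))‖ ^ 2) := by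
  have h := viGapReal_add_le hp hq hφ hlip hQ hD₁ hD₂ hb hσ hτ hS hT hit k x hu hv
  have h1 := inner_le_half_sqNorm hQ (pair (us (k + 1)) (vs (k + 1)) - pair u v)
    (pair 0 (vs (k + 1) - vs k))
  -- After Young's inequality, `-1/4` of each squared `Q`-distance to the test point is left; the
  -- parallelogram bound turns this into the `-1/8` hidden in `Θ`.
  have h2 := sqNorm_sub_le hQ (pair (us (k + 1)) (vs (k + 1)) - pair u v)
    (pair (us k) (vs k) - pair u v)
  rw [sub_sub_sub_cancel_right] at h2
  simp only [ΘSucc]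
  linarith

theorem viGapReal_add_Ψ_le (hp : ClosedProperConvex P.p) (hq : ClosedProperConvex P.q)
    (hφ : Differentiable ℝ P.φ) (hlip : ∃ L : NNReal, LipschitzWith L (gradient P.φ))
    (hQ : P.Q.IsPositive) (hD₁ : P.D₁.IsPositive) (hD₂ : P.D₂.IsPositive)
    (hb : P.HessianBounds) (hcross : P.CrossControl) (hσ : 0 < P.σ) (hτ : 0 < P.τ)
    (hS : P.S.IsPositive) (hT : P.T.IsPositive) (hit : P.IsIterates us vs xs) (k : ℕ)
    {u : U} {v : V} (x : X) (hu : u ∈ dom P.p) (hv : v ∈ dom P.q) :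
    P.viGapReal us vs xs (k + 1) u v x +
        1 / 2 * ((P.Ψ us vs xs (k + 2) u v x + P.ΞSucc us vs (k + 1)) -
          (P.Ψ us vs xs (k + 1) u v x + P.ΞSucc us vs k)) ≤
      -(1 / 2) * (P.ΓSucc us vs (k + 1) + min 1 (1 + P.τ⁻¹ - P.τ) * P.σ *
        ‖P.res (us (k + 2)) (vs (k + 2))‖ ^ 2) := by
  have h := viGapReal_add_le hp hq hφ hlip hQ hD₁ hD₂ hb hσ hτ hS hT hit (k + 1) x hu hv
  have hmono := hit.inner_res_le hp hq hlip hQ hD₁ hD₂ hb hcross hT k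
  simp only [add_assoc, Nat.reduceAdd] at h
  have hres := residual_estimate hσ hτ (P.res (us (k + 1)) (vs (k + 1)))
    (P.res (us (k + 2)) (vs (k + 2))) (adjoint P.B (vs (k + 2) - vs (k + 1)))
  have hr : P.res (us (k + 2)) (vs (k + 1)) =
      P.res (us (k + 2)) (vs (k + 2)) - adjoint P.B (vs (k + 2) - vs (k + 1)) := by
    simp only [res, map_sub]
    abel
  have hBB : sqNorm (P.B ∘L adjoint P.B) (vs (k + 2) - vs (k + 1)) =
      ‖adjoint P.B (vs (k + 2) - vs (k + 1))‖ ^ 2 := by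
    rw [sqNorm, ContinuousLinearMap.comp_apply, ← ContinuousLinearMap.adjoint_inner_left,
      real_inner_self_eq_norm_sq]
  -- The expansion releases `σ⟨res, B*(v^{k+2} - v^{k+1})⟩` at the new residual, exactly the
  -- quantity bounded by `hmono`.
  rw [hr, norm_sub_sq_real] at h
  simp only [Ψ, ΞSucc, ΓSucc, ΘSucc, sqNorm_smul_left, hBB, add_assoc, Nat.reduceAdd]
  have h2 := sqNorm_sub_le hQ (pair (us (k + 2)) (vs (k + 2)) - pair u v)
    (pair (us (k + 1)) (vs (k + 1)) - pair u v)
  have h3 := inner_le_half_sqNorm hQ (pair (us (k + 1)) (vs (k + 1)) - pair u v)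
    (pair 0 (vs (k + 2) - vs (k + 1)))
  have h4 := inner_symm_of_isPositive hQ
    (pair (us (k + 2)) (vs (k + 2)) - pair (us (k + 1)) (vs (k + 1)))
    (pair 0 (vs (k + 2) - vs (k + 1)))
  have hsplit : pair (us (k + 2)) (vs (k + 2)) - pair u v =
      (pair (us (k + 2)) (vs (k + 2)) - pair (us (k + 1)) (vs (k + 1))) +
        (pair (us (k + 1)) (vs (k + 1)) - pair u v) := by abel
  -- The part along the step from `k + 1` to `k + 2` cancels the `Q`-term of `hmono`. The other part
  -- costs half the squared `Q`-distance from the older iterate to the test point, which the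
  -- additional `Q`-term of `Ψ` pays for.
  have h5 : inner ℝ (pair (us (k + 2)) (vs (k + 2)) - pair u v)
      (P.Q (pair 0 (vs (k + 2) - vs (k + 1)))) =
      inner ℝ (pair (us (k + 2)) (vs (k + 2)) - pair (us (k + 1)) (vs (k + 1)))
        (P.Q (pair 0 (vs (k + 2) - vs (k + 1)))) +
      inner ℝ (pair (us (k + 1)) (vs (k + 1)) - pair u v)
        (P.Q (pair 0 (vs (k + 2) - vs (k + 1)))) := by
    rw [hsplit, inner_add_left]
  rw [sub_sub_sub_cancel_right] at h2
  linarith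

end Data

end

end MajADMM

theorem proposition3p1 {U V X : Type*}
    [NormedAddCommGroup U] [InnerProductSpace ℝ U] [FiniteDimensional ℝ U]
    [NormedAddCommGroup V] [InnerProductSpace ℝ V] [FiniteDimensional ℝ V]
    [NormedAddCommGroup X] [InnerProductSpace ℝ X] [FiniteDimensional ℝ X]
    (P : MajADMM.Data U V X)
    (hp : MajADMM.ClosedProperConvex P.p) (hq : MajADMM.ClosedProperConvex P.q)
    (hφ_diff : Differentiable ℝ P.φ) (hφ_conv : ConvexOn ℝ Set.univ P.φ)
    (hφ_lip : ∃ L : NNReal, LipschitzWith L (gradient P.φ))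
    (hQ : P.Q.IsPositive) (hD₁ : P.D₁.IsPositive) (hD₂ : P.D₂.IsPositive)
    (hbound : P.HessianBounds)
    (hη : P.η ∈ Set.Icc (0 : ℝ) 1) (hcross : P.CrossControl)
    (hσ : 0 < P.σ) (hτ : 0 < P.τ)
    (hS : P.S.IsPositive) (hT : P.T.IsPositive)
    (hsol : ∃ u v, P.IsSolution u v) (hcq : P.ConstraintQualification)
    (us : ℕ → U) (vs : ℕ → V) (xs : ℕ → X) (hiter : P.IsIterates us vs xs) :
    (P.τ ≤ 1 → ∀ (k : ℕ) (u : U) (v : V) (x : X),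
      P.viGapSucc us vs xs k u v x +
          ((1 / 2 * (P.Φ us vs xs (k + 1) u v x - P.Φ us vs xs k u v x) : ℝ) : EReal) ≤
        ((-(1 / 2) * (P.ΘSucc us vs k + P.σ * ‖P.res (us (k + 1)) (vs k)‖ ^ 2 +
          (1 - P.τ) * P.σ * ‖P.res (us (k + 1)) (vs (k + 1))‖ ^ 2) : ℝ) : EReal)) ∧
    -- the index `k ≥ 1` of the second inequality is written here as `k + 1` with `k ≥ 0`
    (∀ (k : ℕ) (u : U) (v : V) (x : X),
      P.viGapSucc us vs xs (k + 1) u v x +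
          ((1 / 2 * ((P.Ψ us vs xs (k + 2) u v x + P.ΞSucc us vs (k + 1)) -
            (P.Ψ us vs xs (k + 1) u v x + P.ΞSucc us vs k)) : ℝ) : EReal) ≤
        ((-(1 / 2) * (P.ΓSucc us vs (k + 1) + min 1 (1 + P.τ⁻¹ - P.τ) * P.σ *
          ‖P.res (us (k + 2)) (vs (k + 2))‖ ^ 2) : ℝ) : EReal)) := by

  refine ⟨fun _ k u v x => ?_, fun k u v x => ?_⟩
  · exact MajADMM.Data.viGapSucc_add_le hp hq hiter fun hu hv =>
      MajADMM.Data.viGapReal_add_Φ_le hp hq hφ_diff hφ_lip hQ hD₁ hD₂ hbound hσ hτ hS hT hiter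
        k x hu hv
  · exact MajADMM.Data.viGapSucc_add_le hp hq hiter fun hu hv =>
      MajADMM.Data.viGapReal_add_Ψ_le hp hq hφ_diff hφ_lip hQ hD₁ hD₂ hbound hcross hσ hτ hS hT
        hiter k x hu hv
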